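/- Let $\tau_1,\tau_2,\tau_3$ be the Pauli matrices. Equip $\mathbb{R}^3$ with the Euclidean metric and $SU(2)$ with its canonical bi-invariant metric $h$, induced by $\langle A,B\rangle=\tfrac12\operatorname{Re}\operatorname{tr}(A^*B)$, so that $SU(2)$ is identified with the unit sphere $S^3$ by $(p_0,p)\mapsto p_0 1+i\,p\cdot\tau$. Let $\omega(X,Y)=[\mu(X),\mu(Y)]$, where $\mu$ is the left Maurer–Cartan form of $SU(2)$. For smooth $\varphi:\mathbb{R}^3\to SU(2)$ and the standard basis $e_1,e_2,e_3$ of $\mathbb{R}^3$ put $$E_2(\varphi)=\frac12\int_{\mathbb{R}^3}\sum_i|d\varphi(e_i)|_h^2\,d^3x,\qquad E_4(\varphi)=\frac12\int_{\mathbb{R}^3}\sum_{i<j}|\varphi^*\omega(e_i,e_j)|^2\,d^3x,\qquad F_\alpha=\alpha E_2+(1-\alpha)E_4 .$$ Let $\mathrm{SDiff}$ be the set of volume preserving diffeomorphisms of $\mathbb{R}^3$ that are the identity outside a compact set, and $\Gamma_0$ the space of smooth, compactly supported, divergence-free vector fields on $\mathbb{R}^3$. A smooth family $\psi_p$ in $\mathrm{SDiff}$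 is one that is jointly smooth in $(p,x)$ and whose members are supported in a common compact set as $p$ ranges over any compact set of parameters. A smooth map $\varphi:\mathbb{R}^3\to SU(2)$ is restricted $F$-critical if $F(\varphi)<\infty$ and $\frac{d}{dt}\big|_{t=0}F(\varphi\circ\psi_t)=0$ for every smooth curve $\psi_t$ in $\mathrm{SDiff}$ with $\psi_0=\mathrm{id}$. It is stable if moreover there is a bilinear form $\mathrm{Hess}$ on $\Gamma_0$ (the hessian of $F$ at $\varphi$) such that $$\mathrm{Hess}(X,Y)=\frac{\partial^2F(\varphi\circ\psi_{s,t})}{\partial s\,\partial t}\Big|_{s=t=0}$$ (the derivative existing) for all $X,Y\in\Gamma_0$ and every smooth two-parameter family $\psi_{s,t}$ in $\mathrm{SDiff}$ with $\psi_{0,0}=\mathrm{id}$, $\partial_s\psi_{s,t}|_{s=t=0}=X$ and $\partial_t\psi_{s,t}|_{s=t=0}=Y$, and such that $\mathrm{Hess}(X,X)\ge 0$ for all $X\in\Gamma_0$. Then, for every $\alpha\in[0,1]$, inverse stereographic projection $$\varphi:\mathbb{R}^3\to S^3=SU(2),\qquad \varphi(x)=\frac{(|x|^2-1)\,1+2i\,x\cdot\tau}{|x|^2+1},$$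 is a stable restricted $F_\alpha$-critical map. -/

import Mathlib

open scoped Manifold ContDiff

noncomputable section

namespace Skyrme

/-- Physical space: Euclidean `ℝ³`. -/
abbrev E3 : Type := EuclideanSpace ℝ (Fin 3)

/-- The group `SU(2)`. -/
abbrev SU2 : Type := Matrix.specialUnitaryGroup (Fin 2) ℂ

/-- The `i`-th standard basis vector of `ℝ³`. -/
def stdVec (i : Fin 3) : E3 := EuclideanSpace.single i 1

/-! ### Maps from `ℝ³` to `SU(2)` and their energies -/

/-- Smoothness of a map into the embedded submanifold `SU(2)` of the `2 × 2` complex matrices. -/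
def IsSmoothMap (φ : E3 → SU2) : Prop :=
  ∀ a b : Fin 2, ContDiff ℝ ∞ (fun x => (φ x : Matrix (Fin 2) (Fin 2) ℂ) a b)

/-- The differential `dφ_x(v)`, a tangent vector to `SU(2)` at `φ x`, seen as a matrix. -/
def dmap (φ : E3 → SU2) (x v : E3) : Matrix (Fin 2) (Fin 2) ℂ :=
  Matrix.of fun a b => fderiv ℝ (fun y => (φ y : Matrix (Fin 2) (Fin 2) ℂ) a b) x v

/-- The inner product `⟨A, B⟩ = ½ Re tr(A* B)`. On the tangent spaces of `SU(2)` it is the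
canonical bi-invariant metric `h`, for which `SU(2)` is the unit sphere `S³`; on
`𝔰𝔲(2) = T_1 SU(2)` it makes `i τ₁, i τ₂, i τ₃` orthonormal (`τ_a` the Pauli matrices). -/
def ip (A B : Matrix (Fin 2) (Fin 2) ℂ) : ℝ :=
  (1 / 2) * (Matrix.trace (star A * B)).re

/-- The Dirichlet energy `E₂(φ) = ½ ∫ |dφ|²`. -/
def E2 (φ : E3 → SU2) : ENNReal :=
  ∫⁻ x : E3, ENNReal.ofReal
    ((1 / 2) * ∑ i : Fin 3, ip (dmap φ x (stdVec i)) (dmap φ x (stdVec i)))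

/-- The pullback `φ^* μ` of the left Maurer-Cartan form `μ` of `SU(2)`. -/
def mcForm (φ : E3 → SU2) (x v : E3) : Matrix (Fin 2) (Fin 2) ℂ :=
  ((φ x)⁻¹ : SU2) * dmap φ x v

/-- The pullback `φ^* ω` of the `𝔰𝔲(2)`-valued two-form `ω(X, Y) = [μ(X), μ(Y)]`. -/
def omegaForm (φ : E3 → SU2) (x v w : E3) : Matrix (Fin 2) (Fin 2) ℂ :=
  ⁅mcForm φ x v, mcForm φ x w⁆

/-- The Skyrme term `E₄(φ) = ½ ∫ |φ^* ω|²`, where `|φ^* ω|² = ∑_{i < j} |φ^* ω(e_i, e_j)|²`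
is the usual norm of a two-form (hence the factor `½` in front of the full double sum). -/
def E4 (φ : E3 → SU2) : ENNReal :=
  ∫⁻ x : E3, ENNReal.ofReal ((1 / 2) * ((1 / 2) * ∑ i : Fin 3, ∑ j : Fin 3,
    ip (omegaForm φ x (stdVec i) (stdVec j)) (omegaForm φ x (stdVec i) (stdVec j))))

/-- `F_α = α E₂ + (1 - α) E₄`, for `0 ≤ α ≤ 1`. -/
def Falpha (α : ℝ) (φ : E3 → SU2) : ENNReal :=
  ENNReal.ofReal α * E2 φ + ENNReal.ofReal (1 - α) * E4 φ

/-! ### Volume preserving diffeomorphisms and divergenceless vector fields -/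

/-- Volume preserving diffeomorphisms of `ℝ³` of compact support. -/
def SDiff : Set (E3 ≃ₘ[ℝ] E3) :=
  {ψ | (∀ x, (fderiv ℝ ψ x).det = 1) ∧ IsCompact (closure {x | ψ x ≠ x})}

/-- A smooth family of elements of `SDiff` through `id`, with parameter in a normed space `P`
(`P = ℝ` for curves, `P = ℝ × ℝ` for two-parameter variations): it is jointly smooth, equals
`id` at the parameter `0`, and its members are supported in a common compact set as the
parameter ranges over a compact set. -/
structure IsSmoothFamily {P : Type} [NormedAddCommGroup P] [NormedSpace ℝ P]
    (ψ : P → (E3 ≃ₘ[ℝ] E3)) : Prop where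
  mem : ∀ p, ψ p ∈ SDiff
  zero : ∀ x, ψ 0 x = x
  smooth : ContDiff ℝ ∞ (fun q : P × E3 => ψ q.1 q.2)
  support : ∀ J : Set P, IsCompact J → ∃ K : Set E3, IsCompact K ∧
    ∀ p ∈ J, ∀ x, x ∉ K → ψ p x = x

/-- The divergence of a vector field on `ℝ³`. -/
def divg (X : E3 → E3) (x : E3) : ℝ := ∑ i : Fin 3, (fderiv ℝ X x (stdVec i)) i

/-- The space `Γ₀` of smooth divergenceless vector fields of compact support on `ℝ³`. -/
def Gamma0 : Submodule ℝ (E3 → E3) where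
  carrier := {X | ContDiff ℝ ∞ X ∧ HasCompactSupport X ∧ ∀ x, divg X x = 0}
  zero_mem' := by
    refine ⟨contDiff_const, HasCompactSupport.zero, fun x => ?_⟩
    have h : fderiv ℝ (0 : E3 → E3) x = 0 := by
      simp
    simp [divg, h]
  add_mem' := by
    rintro X Y ⟨hX, hX', hX''⟩ ⟨hY, hY', hY''⟩
    refine ⟨hX.add hY, hX'.add hY', fun x => ?_⟩
    have h : fderiv ℝ (X + Y) x = fderiv ℝ X x + fderiv ℝ Y x :=
      fderiv_add (hX.differentiable (by simp) x) (hY.differentiable (by simp) x)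
    have h1 := hX'' x
    have h2 := hY'' x
    simp only [divg] at h1 h2 ⊢
    simp [h, Finset.sum_add_distrib, h1, h2]
  smul_mem' := by
    rintro c X ⟨hX, hX', hX''⟩
    refine ⟨contDiff_const.smul hX, hX'.smul_left (f := fun _ => c), fun x => ?_⟩
    have h : fderiv ℝ (c • X) x = c • fderiv ℝ X x :=
      fderiv_const_smul (hX.differentiable (by simp) x) c
    have h1 := hX'' x
    simp only [divg] at h1 ⊢
    simp [h, ← Finset.mul_sum, h1]

/-- A two-parameter variation `ψ_{s,t}` of `id` in `SDiff` tangent to `X, Y`: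
`X = ∂_s ψ_{s,t}` and `Y = ∂_t ψ_{s,t}` at `s = t = 0`. -/
structure IsVariation (X Y : E3 → E3) (ψ : ℝ × ℝ → (E3 ≃ₘ[ℝ] E3)) : Prop where
  family : IsSmoothFamily ψ
  tangent_fst : ∀ x, HasDerivAt (fun s : ℝ => ψ (s, 0) x) (X x) 0
  tangent_snd : ∀ x, HasDerivAt (fun t : ℝ => ψ (0, t) x) (Y x) 0

/-! ### Restricted criticality and stability -/

/-- `φ` is restricted `F`-critical: it is smooth, `F(φ)` is finite, and
`d/dt F(φ ∘ ψ_t) = 0` at `t = 0` for all smooth curves `ψ_t` in `SDiff` with `ψ_0 = id`. -/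
def IsRestrictedCritical (F : (E3 → SU2) → ENNReal) (φ : E3 → SU2) : Prop :=
  IsSmoothMap φ ∧ F φ ≠ ⊤ ∧
    ∀ ψ : ℝ → (E3 ≃ₘ[ℝ] E3), IsSmoothFamily ψ →
      HasDerivAt (fun t : ℝ => (F (φ ∘ ψ t)).toReal) 0 0

/-- The mixed partial derivative `∂²f/∂s∂t` at `s = t = 0` exists and equals `c`. -/
def HasMixedDeriv (f : ℝ → ℝ → ℝ) (c : ℝ) : Prop :=
  ∃ D : ℝ → ℝ, (∀ᶠ s in nhds (0 : ℝ), HasDerivAt (f s) (D s) 0) ∧ HasDerivAt D c 0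

/-- The bilinear form `B` on `Γ₀` is the hessian of `F` at `φ`: for all `X, Y` and every
two-parameter variation `ψ_{s,t}` tangent to `X, Y`, `B(X, Y)` is the value of
`∂²F(φ ∘ ψ_{s,t})/∂s∂t` at `s = t = 0`. -/
def IsHessian (F : (E3 → SU2) → ENNReal) (φ : E3 → SU2) (B : LinearMap.BilinForm ℝ Gamma0) :
    Prop :=
  ∀ (X Y : Gamma0) (ψ : ℝ × ℝ → (E3 ≃ₘ[ℝ] E3)), IsVariation X Y ψ →
    HasMixedDeriv (fun s t => (F (φ ∘ ψ (s, t))).toReal) (B X Y)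

/-- `φ` is a stable restricted `F`-critical map: it is restricted `F`-critical, and its
hessian `Hess` exists and satisfies `Hess(X, X) ≥ 0` for all `X ∈ Γ₀`. -/
def IsStableRestrictedCritical (F : (E3 → SU2) → ENNReal) (φ : E3 → SU2) : Prop :=
  IsRestrictedCritical F φ ∧
    ∃ B : LinearMap.BilinForm ℝ Gamma0, IsHessian F φ B ∧ ∀ X : Gamma0, 0 ≤ B X X

/-! ### Inverse stereographic projection -/

/-- The matrix `p₀ 1 + i (p₁ τ₁ + p₂ τ₂ + p₃ τ₃)`, with `τ_a` the Pauli matrices; for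
`p₀² + |p|² = 1` this is the standard identification of `S³` with `SU(2)`. -/
def quatMatrix (p₀ : ℝ) (p : E3) : Matrix (Fin 2) (Fin 2) ℂ :=
  !![(p₀ : ℂ) + Complex.I * (p 2 : ℂ), (p 1 : ℂ) + Complex.I * (p 0 : ℂ);
    -(p 1 : ℂ) + Complex.I * (p 0 : ℂ), (p₀ : ℂ) - Complex.I * (p 2 : ℂ)]

lemma quatMatrix_mem (p₀ : ℝ) (p : E3) (h : p₀ ^ 2 + ‖p‖ ^ 2 = 1) :
    quatMatrix p₀ p ∈ Matrix.specialUnitaryGroup (Fin 2) ℂ := by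
  have h1 : p₀ ^ 2 + (p 0 ^ 2 + p 1 ^ 2 + p 2 ^ 2) = 1 := by
    rw [EuclideanSpace.real_norm_sq_eq, Fin.sum_univ_three] at h
    exact h
  rw [Matrix.mem_specialUnitaryGroup_iff, Matrix.mem_unitaryGroup_iff]
  constructor
  · ext a b
    fin_cases a <;> fin_cases b <;>
      simp [quatMatrix, Matrix.mul_apply, Matrix.star_apply, Fin.sum_univ_two,
        Complex.ext_iff] <;> constructor <;> nlinarith [h1]
  · rw [quatMatrix, Matrix.det_fin_two_of]
    simp [Complex.ext_iff]
    constructor <;> nlinarith [h1]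

lemma stereo_sphere (x : E3) :
    ((‖x‖ ^ 2 - 1) / (‖x‖ ^ 2 + 1)) ^ 2 + ‖(2 / (‖x‖ ^ 2 + 1)) • x‖ ^ 2 = 1 := by
  have h : (0 : ℝ) < ‖x‖ ^ 2 + 1 := by positivity
  rw [norm_smul, Real.norm_of_nonneg (by positivity)]
  field_simp
  ring

/-- Inverse stereographic projection `ℝ³ → S³ = SU(2)`,
`x ↦ ((|x|² - 1) 1 + 2 i x·τ) / (|x|² + 1)`: projection from the pole `1` onto the
equatorial hyperplane. -/
def invStereo (x : E3) : SU2 :=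
  ⟨quatMatrix ((‖x‖ ^ 2 - 1) / (‖x‖ ^ 2 + 1)) ((2 / (‖x‖ ^ 2 + 1)) • x),
    quatMatrix_mem _ _ (stereo_sphere x)⟩

end Skyrme

end

namespace Skyrme

/-! Inverse stereographic projection is conformal: it pulls `h` back to `λ²` times the Euclidean
metric, with `λ = conformalFactor`. The density of `F_α(φ ∘ ψ)` therefore depends on `ψ` only
through `λ(ψ x)` and the Gram matrix `G = NᵀN` of the differential `N` of `ψ`. Since `ψ` preserves
volume, the integral can be moved to `y = ψ x` at no cost (`Falpha_comp_invStereo`). The factor `λ`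
then sits at the fixed point `y`, and all the variation is in `G`.

Along a family through the identity, `N` starts at `1` and has determinant one. With first
derivatives `A`, `B` and mixed derivative `C`, expanding `det N = 1` gives `tr A = tr B = 0` and `tr
C = tr (AB)` (`JetAt.det_eq_one`). At `G = 1` the first variation of the density is a multiple of
`tr A`, so it vanishes pointwise. In the second variation only `tr C` enters; replacing it by `tr
(AB)` leaves a nonnegative weight times the inner product of `A + Aᵀ` and `B + Bᵀ`
(`jetAt_familyDensity`). Here `A`, `B` are the Jacobians of the generating fields
(`fderiv_jacobianMatrix`), so the hessian depends only on `X`, `Y` and is positive semidefinite.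

Analytically, `λ²` and `λ⁴` are integrable on `ℝ³`, and a family changes the density only in a
compact set, which allows differentiation under the integral. -/

open MeasureTheory

/-! ### Inverse stereographic projection and its differential -/

/-- The conformal factor `2 / (1 + |x|²)` of inverse stereographic projection. -/
noncomputable def conformalFactor (x : E3) : ℝ := 2 / (‖x‖ ^ 2 + 1)

lemma conformalFactor_pos (x : E3) : 0 < conformalFactor x := by
  unfold conformalFactor; positivity

lemma conformalFactor_mul (x : E3) : conformalFactor x * (‖x‖ ^ 2 + 1) = 2 := by
  have : ‖x‖ ^ 2 + 1 ≠ 0 := by positivity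
  unfold conformalFactor; field_simp

lemma contDiff_conformalFactor : ContDiff ℝ ∞ conformalFactor :=
  contDiff_const.div ((contDiff_norm_sq ℝ).add contDiff_const) fun x => by positivity

lemma invStereo_eq (x : E3) : (invStereo x : Matrix (Fin 2) (Fin 2) ℂ) =
    quatMatrix (1 - conformalFactor x) (conformalFactor x • x) := by
  have : ‖x‖ ^ 2 + 1 ≠ 0 := by positivity
  have h : (‖x‖ ^ 2 - 1) / (‖x‖ ^ 2 + 1) = 1 - conformalFactor x := by
    unfold conformalFactor; field_simp; ring
  simp only [invStereo, h]
  rfl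

lemma fderiv_conformalFactor (x v : E3) :
    fderiv ℝ conformalFactor x v = -(conformalFactor x ^ 2 * inner ℝ x v) := by
  have h0 : ‖x‖ ^ 2 + 1 ≠ 0 := by positivity
  have h1 : HasFDerivAt (fun y : E3 => ‖y‖ ^ 2 + 1) (2 • innerSL ℝ x) x :=
    ((hasStrictFDerivAt_norm_sq x).hasFDerivAt).add_const 1
  have h2 := ((hasDerivAt_inv h0).comp_hasFDerivAt x h1).const_mul 2
  have h3 : conformalFactor = fun y => 2 * ((fun z => z⁻¹) ∘ fun y : E3 => ‖y‖ ^ 2 + 1) y := by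
    ext y; simp [conformalFactor, div_eq_mul_inv]
  rw [h3, h2.fderiv]
  simp
  field_simp

/-- The entries of `quatMatrix` as continuous linear maps. -/
noncomputable def quatEntry (a b : Fin 2) : ℝ × E3 →L[ℝ] ℂ :=
  LinearMap.toContinuousLinearMap
    { toFun := fun q => quatMatrix q.1 q.2 a b
      map_add' := fun q r => by
        fin_cases a <;> fin_cases b <;> simp [quatMatrix] <;> ring
      map_smul' := fun c q => by
        fin_cases a <;> fin_cases b <;> simp [quatMatrix] <;> ring }

lemma quatEntry_apply (a b : Fin 2) (q : ℝ × E3) : quatEntry a b q = quatMatrix q.1 q.2 a b := rfl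

lemma contDiff_stereoPair :
    ContDiff ℝ ∞ fun x : E3 => ((1 - conformalFactor x, conformalFactor x • x) : ℝ × E3) :=
  (contDiff_const.sub contDiff_conformalFactor).prodMk (contDiff_conformalFactor.smul contDiff_id)

lemma invStereo_entry (a b : Fin 2) :
    (fun x => (invStereo x : Matrix (Fin 2) (Fin 2) ℂ) a b) =
      fun x => quatEntry a b (1 - conformalFactor x, conformalFactor x • x) := by
  ext x
  rw [invStereo_eq, quatEntry_apply]

lemma isSmoothMap_invStereo : IsSmoothMap invStereo := by
  intro a b
  rw [invStereo_entry]
  exact (quatEntry a b).contDiff.comp contDiff_stereoPair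

lemma dmap_invStereo (x v : E3) : dmap invStereo x v =
    quatMatrix (conformalFactor x ^ 2 * inner ℝ x v)
      (conformalFactor x • v - (conformalFactor x ^ 2 * inner ℝ x v) • x) := by
  have hf : HasFDerivAt conformalFactor (fderiv ℝ conformalFactor x) x :=
    (contDiff_conformalFactor.differentiable (by simp) x).hasFDerivAt
  have hp := (hf.const_sub 1).prodMk (hf.smul (hasFDerivAt_id x))
  ext a b
  have h := ((quatEntry a b).hasFDerivAt.comp x hp).fderiv
  simp only [dmap, Matrix.of_apply]
  rw [invStereo_entry]
  refine (congrArg (fun T => T v) h).trans ?_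
  simp [fderiv_conformalFactor, quatEntry_apply, sub_eq_add_neg]

lemma dmap_comp {φ : E3 → SU2} (hφ : IsSmoothMap φ) {ψ : E3 → E3} {x : E3}
    (hψ : DifferentiableAt ℝ ψ x) (v : E3) :
    dmap (φ ∘ ψ) x v = dmap φ (ψ x) (fderiv ℝ ψ x v) := by
  ext a b
  have h := fderiv_comp (𝕜 := ℝ) x ((hφ a b).differentiable (by simp) (ψ x)) hψ
  exact congrArg (fun T => T v) h

/-! ### Quaternion algebra; pullback of the metric and of the two-form -/

lemma inner_E3 (u v : E3) : inner ℝ u v = u 0 * v 0 + u 1 * v 1 + u 2 * v 2 := by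
  simp [PiLp.inner_apply, Fin.sum_univ_three, mul_comm]

lemma ip_quatMatrix (a b : ℝ) (u v : E3) :
    ip (quatMatrix a u) (quatMatrix b v) = a * b + inner ℝ u v := by
  rw [inner_E3]
  simp [ip, quatMatrix, Matrix.trace_fin_two, Matrix.mul_apply, Fin.sum_univ_two]
  ring

lemma ip_unitary_mul (U : SU2) (A B : Matrix (Fin 2) (Fin 2) ℂ) :
    ip ((U : Matrix (Fin 2) (Fin 2) ℂ) * A) ((U : Matrix (Fin 2) (Fin 2) ℂ) * B) = ip A B := by
  have h : star (U : Matrix (Fin 2) (Fin 2) ℂ) * (U : Matrix (Fin 2) (Fin 2) ℂ) = 1 :=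
    (Matrix.mem_unitaryGroup_iff'.1 (Matrix.mem_specialUnitaryGroup_iff.1 U.2).1)
  unfold ip
  rw [star_mul, mul_assoc, ← mul_assoc (star (U : Matrix (Fin 2) (Fin 2) ℂ)), h, one_mul]

/-- Conformality. The terms in `⟨x, v⟩⟨x, w⟩` cancel because `λ (|x|² + 1) = 2`. -/
lemma ip_dmap_invStereo (x v w : E3) :
    ip (dmap invStereo x v) (dmap invStereo x w) = conformalFactor x ^ 2 * inner ℝ v w := by
  rw [dmap_invStereo, dmap_invStereo, ip_quatMatrix]
  have h := conformalFactor_mul x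
  have h2 := real_inner_self_eq_norm_sq x
  rw [← h2] at h
  simp only [inner_sub_left, inner_sub_right, real_inner_smul_left, real_inner_smul_right,
    real_inner_comm x v]
  linear_combination conformalFactor x ^ 3 * inner ℝ x v * inner ℝ x w * h

/-- The cross product. -/
noncomputable def cross (u v : E3) : E3 :=
  !₂[u 1 * v 2 - u 2 * v 1, u 2 * v 0 - u 0 * v 2, u 0 * v 1 - u 1 * v 0]

lemma lie_quatMatrix (u v : E3) :
    ⁅quatMatrix 0 u, quatMatrix 0 v⁆ = quatMatrix 0 ((-2 : ℝ) • cross u v) := by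
  ext a b
  fin_cases a <;> fin_cases b <;>
    simp [quatMatrix, Ring.lie_def, cross, Complex.ext_iff] <;>
    (try constructor) <;> ring

lemma ip_lie_quatMatrix (u v : E3) :
    ip ⁅quatMatrix 0 u, quatMatrix 0 v⁆ ⁅quatMatrix 0 u, quatMatrix 0 v⁆ =
      4 * (inner ℝ u u * inner ℝ v v - inner ℝ u v * inner ℝ u v) := by
  rw [lie_quatMatrix, ip_quatMatrix]
  simp only [inner_E3, cross]
  simp
  ring

/-- The scalar part of `q̄ r` is the inner product of `q` and `r` in `ℝ⁴`, so orthogonal quaternions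
give a purely imaginary product. This places the Maurer–Cartan form in `𝔰𝔲(2)`, where the bracket is
a cross product. -/
lemma quatMatrix_conj_mul (a b : ℝ) (u v : E3) (h : a * b + inner ℝ u v = 0) :
    ∃ w, star (quatMatrix a u) * quatMatrix b v = quatMatrix 0 w := by
  refine ⟨a • v - b • u + cross u v, ?_⟩
  rw [inner_E3] at h
  ext i j
  fin_cases i <;> fin_cases j <;>
    simp [quatMatrix, Matrix.star_apply, cross, Matrix.mul_apply, Fin.sum_univ_two,
      Complex.ext_iff] <;>
    (try constructor) <;> linarith

lemma exists_mcForm_invStereo (x v : E3) : ∃ w, mcForm invStereo x v = quatMatrix 0 w := by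
  have h : (((invStereo x)⁻¹ : SU2) : Matrix (Fin 2) (Fin 2) ℂ) =
      star (invStereo x : Matrix (Fin 2) (Fin 2) ℂ) := rfl
  rw [mcForm, h, invStereo_eq, dmap_invStereo]
  apply quatMatrix_conj_mul
  have h := conformalFactor_mul x
  rw [← real_inner_self_eq_norm_sq x] at h
  simp only [inner_sub_right, real_inner_smul_left, real_inner_smul_right]
  linear_combination -conformalFactor x ^ 2 * inner ℝ x v * h

/-- On imaginary quaternions the bracket is `-2` times the cross product, so Lagrange's identity
expresses its norm by inner products. By left invariance these are the inner products of `dφ`, known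
from conformality. -/
lemma ip_omegaForm_invStereo (x v w : E3) :
    ip (omegaForm invStereo x v w) (omegaForm invStereo x v w) =
      4 * conformalFactor x ^ 4 * (inner ℝ v v * inner ℝ w w - inner ℝ v w * inner ℝ v w) := by
  obtain ⟨a, ha⟩ := exists_mcForm_invStereo x v
  obtain ⟨b, hb⟩ := exists_mcForm_invStereo x w
  have h : ∀ v w, ip (mcForm invStereo x v) (mcForm invStereo x w) =
      conformalFactor x ^ 2 * inner ℝ v w := fun v w => by
    rw [mcForm, mcForm, ip_unitary_mul, ip_dmap_invStereo]
  have h1 := h v v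
  have h2 := h v w
  have h3 := h w w
  rw [ha, ip_quatMatrix, zero_mul, zero_add] at h1
  rw [hb, ip_quatMatrix, zero_mul, zero_add] at h3
  rw [ha, hb, ip_quatMatrix, zero_mul, zero_add] at h2
  rw [omegaForm, ha, hb, ip_lie_quatMatrix, h1, h2, h3]
  ring

lemma omegaForm_comp {φ : E3 → SU2} (hφ : IsSmoothMap φ) {ψ : E3 → E3} {x : E3}
    (hψ : DifferentiableAt ℝ ψ x) (v w : E3) :
    omegaForm (φ ∘ ψ) x v w = omegaForm φ (ψ x) (fderiv ℝ ψ x v) (fderiv ℝ ψ x w) := by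
  simp only [omegaForm, mcForm, dmap_comp hφ hψ, Function.comp_apply]

/-! ### The energy density as a function of the Gram matrix -/

/-- The density of `F_α` at the point `y` of the image, as a function of the Gram matrix of the
differential of the inner map. -/
noncomputable def skyrmeDensity (α : ℝ) (y : E3) (G : Fin 3 → Fin 3 → ℝ) : ℝ :=
  α * (1 / 2 * (conformalFactor y ^ 2 * ∑ i, G i i)) +
    (1 - α) * (conformalFactor y ^ 4 * ∑ i, ∑ j, (G i i * G j j - G i j * G i j))

/-- The Gram matrix of a linear map in the standard basis. -/
noncomputable def gram (T : E3 →L[ℝ] E3) (i j : Fin 3) : ℝ :=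
  inner ℝ (T (stdVec i)) (T (stdVec j))

lemma skyrmeDensity_gram_nonneg {α : ℝ} (hα : α ∈ Set.Icc (0 : ℝ) 1) (y : E3)
    (T : E3 →L[ℝ] E3) : 0 ≤ skyrmeDensity α y (gram T) := by
  have h1 : 0 ≤ ∑ i, gram T i i := Finset.sum_nonneg fun i _ => real_inner_self_nonneg
  have h2 : 0 ≤ ∑ i, ∑ j, (gram T i i * gram T j j - gram T i j * gram T i j) :=
    Finset.sum_nonneg fun i _ => Finset.sum_nonneg fun j _ =>
      sub_nonneg.2 (real_inner_mul_inner_self_le _ _)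
  have h3 := sub_nonneg.2 hα.2
  have h4 := hα.1
  unfold skyrmeDensity
  positivity

lemma lintegral_comp_diffeo {ψ : E3 ≃ₘ[ℝ] E3} (hψ : ψ ∈ SDiff) (f : E3 → ENNReal) :
    ∫⁻ x, f (ψ x) = ∫⁻ y, f y := by
  have h := lintegral_image_eq_lintegral_abs_det_fderiv_mul volume MeasurableSet.univ
    (fun x _ => ((ψ.contDiff.differentiable (by simp)) x).hasFDerivAt.hasFDerivWithinAt)
    ψ.injective.injOn f
  have h0 : (ψ : E3 → E3) '' Set.univ = Set.univ := Set.image_univ_of_surjective ψ.surjective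
  rw [h0, setLIntegral_univ, setLIntegral_univ] at h
  rw [h]
  exact lintegral_congr fun x => by rw [hψ.1 x]; simp

/-- The chain rule produces the density at `ψ x`; the substitution `y = ψ x` has Jacobian one and
frees the conformal factor from `ψ`. -/
lemma Falpha_comp_invStereo {α : ℝ} (hα : α ∈ Set.Icc (0 : ℝ) 1) {ψ : E3 ≃ₘ[ℝ] E3}
    (hψ : ψ ∈ SDiff) : Falpha α (invStereo ∘ ψ) =
      ∫⁻ y, ENNReal.ofReal (skyrmeDensity α y (gram (fderiv ℝ ψ (ψ.symm y)))) := by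
  have hd : ∀ x, DifferentiableAt ℝ ψ x := ψ.contDiff.differentiable (by simp)
  have hc : ContDiff ℝ ∞ ψ := ψ.contDiff
  have hg : ∀ i j, Continuous fun x => gram (fderiv ℝ ψ x) i j := fun i j => by
    have := hc.continuous_fderiv (by simp)
    unfold gram
    fun_prop
  have hf : Continuous fun x => conformalFactor (ψ x) :=
    contDiff_conformalFactor.continuous.comp hc.continuous
  have h2 : E2 (invStereo ∘ ψ) = ∫⁻ x, ENNReal.ofReal
      (1 / 2 * (conformalFactor (ψ x) ^ 2 * ∑ i, gram (fderiv ℝ ψ x) i i)) := by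
    refine lintegral_congr fun x => ?_
    simp only [dmap_comp isSmoothMap_invStereo (hd x), ip_dmap_invStereo, ← Finset.mul_sum, gram]
  have h4 : E4 (invStereo ∘ ψ) = ∫⁻ x, ENNReal.ofReal
      (conformalFactor (ψ x) ^ 4 * ∑ i, ∑ j, (gram (fderiv ℝ ψ x) i i * gram (fderiv ℝ ψ x) j j -
        gram (fderiv ℝ ψ x) i j * gram (fderiv ℝ ψ x) i j)) := by
    refine lintegral_congr fun x => ?_
    simp only [omegaForm_comp isSmoothMap_invStereo (hd x), ip_omegaForm_invStereo,
      ← Finset.mul_sum, gram]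
    congr 1
    ring
  rw [Falpha, h2, h4, ← lintegral_const_mul _ (by fun_prop), ← lintegral_const_mul _ (by fun_prop),
    ← lintegral_add_left (by fun_prop)]
  refine Eq.trans ?_ (lintegral_comp_diffeo hψ _)
  refine lintegral_congr fun x => ?_
  have e1 : 0 ≤ ∑ i, gram (fderiv ℝ ψ x) i i := Finset.sum_nonneg fun i _ => real_inner_self_nonneg
  have e2 : 0 ≤ ∑ i, ∑ j, (gram (fderiv ℝ ψ x) i i * gram (fderiv ℝ ψ x) j j -
      gram (fderiv ℝ ψ x) i j * gram (fderiv ℝ ψ x) i j) :=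
    Finset.sum_nonneg fun i _ => Finset.sum_nonneg fun j _ =>
      sub_nonneg.2 (real_inner_mul_inner_self_le _ _)
  have e3 := sub_nonneg.2 hα.2
  have e4 := hα.1
  rw [← ENNReal.ofReal_mul e4, ← ENNReal.ofReal_mul e3, ← ENNReal.ofReal_add (by positivity)
    (by positivity)]
  simp only [skyrmeDensity, ψ.symm_apply_apply]

/-! ### Calculus of second order jets -/

section Jets

variable {V : Type*} [NormedAddCommGroup V] [NormedSpace ℝ V]

/-- `F` is smooth, and at `q` it has the value `a`, the derivatives `b`, `c` in the directions
`v`, `w`, and the mixed second derivative `d`. -/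
structure JetAt (q v w : V) (F : V → ℝ) (a b c d : ℝ) : Prop where
  smooth : ContDiff ℝ ∞ F
  value : F q = a
  fst : fderiv ℝ F q v = b
  snd : fderiv ℝ F q w = c
  mixed : fderiv ℝ (fun r => fderiv ℝ F r w) q v = d

lemma contDiff_fderiv_dir {F : V → ℝ} (hF : ContDiff ℝ ∞ F) (w : V) :
    ContDiff ℝ ∞ fun r => fderiv ℝ F r w :=
  (hF.fderiv_right (by simp)).clm_apply contDiff_const

variable {q v w : V} {F G : V → ℝ} {a b c d a' b' c' d' : ℝ}

lemma JetAt.of_contDiff (hF : ContDiff ℝ ∞ F) : JetAt q v w F (F q) (fderiv ℝ F q v)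
    (fderiv ℝ F q w) (fderiv ℝ (fun r => fderiv ℝ F r w) q v) := ⟨hF, rfl, rfl, rfl, rfl⟩

lemma JetAt.congr (h : JetAt q v w F a b c d) (ha : a = a') (hb : b = b') (hc : c = c')
    (hd : d = d') : JetAt q v w F a' b' c' d' := by subst ha hb hc hd; exact h

lemma JetAt.const (k : ℝ) : JetAt q v w (fun _ => k) k 0 0 0 :=
  ⟨contDiff_const, rfl, by simp, by simp, by simp⟩

lemma JetAt.add (hF : JetAt q v w F a b c d) (hG : JetAt q v w G a' b' c' d') :
    JetAt q v w (fun r => F r + G r) (a + a') (b + b') (c + c') (d + d') := by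
  have dF := hF.smooth.differentiable (by simp)
  have dG := hG.smooth.differentiable (by simp)
  have dF' := (contDiff_fderiv_dir hF.smooth w).differentiable (by simp)
  have dG' := (contDiff_fderiv_dir hG.smooth w).differentiable (by simp)
  have h : ∀ r u, fderiv ℝ (fun r => F r + G r) r u = fderiv ℝ F r u + fderiv ℝ G r u :=
    fun r u => by rw [fderiv_fun_add (dF r) (dG r)]; rfl
  refine ⟨hF.smooth.add hG.smooth, by rw [hF.value, hG.value], by rw [h, hF.fst, hG.fst],
    by rw [h, hF.snd, hG.snd], ?_⟩
  simp only [h]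
  rw [fderiv_fun_add (dF' q) (dG' q)]
  simp [hF.mixed, hG.mixed]

lemma JetAt.mul (hF : JetAt q v w F a b c d) (hG : JetAt q v w G a' b' c' d') :
    JetAt q v w (fun r => F r * G r) (a * a') (a * b' + b * a') (a * c' + c * a')
      (a * d' + b * c' + c * b' + d * a') := by
  have dF := hF.smooth.differentiable (by simp)
  have dG := hG.smooth.differentiable (by simp)
  have dF' := (contDiff_fderiv_dir hF.smooth w).differentiable (by simp)
  have dG' := (contDiff_fderiv_dir hG.smooth w).differentiable (by simp)
  have h : ∀ r u, fderiv ℝ (fun r => F r * G r) r u =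
      F r * fderiv ℝ G r u + fderiv ℝ F r u * G r :=
    fun r u => by rw [fderiv_fun_mul (dF r) (dG r)]; simp [mul_comm]
  refine ⟨hF.smooth.mul hG.smooth, by rw [hF.value, hG.value],
    by rw [h, hF.fst, hG.fst, hF.value, hG.value],
    by rw [h, hF.snd, hG.snd, hF.value, hG.value], ?_⟩
  simp only [h]
  rw [fderiv_fun_add ((dF q).fun_mul (dG' q)) ((dF' q).fun_mul (dG q)), fderiv_fun_mul (dF q) (dG' q),
    fderiv_fun_mul (dF' q) (dG q)]
  simp [hF.mixed, hG.mixed, hF.fst, hG.fst, hF.snd, hG.snd, hF.value, hG.value]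
  ring

lemma JetAt.sub (hF : JetAt q v w F a b c d) (hG : JetAt q v w G a' b' c' d') :
    JetAt q v w (fun r => F r - G r) (a - a') (b - b') (c - c') (d - d') := by
  have := hF.add ((JetAt.const (-1)).mul hG)
  have h : (fun r => F r - G r) = fun r => F r + (-1) * G r := by ext; ring
  rw [h]
  exact this.congr (by ring) (by ring) (by ring) (by ring)

lemma JetAt.sum {ι : Type*} (s : Finset ι) {F : ι → V → ℝ} {a b c d : ι → ℝ}
    (h : ∀ i, JetAt q v w (F i) (a i) (b i) (c i) (d i)) :
    JetAt q v w (fun r => ∑ i ∈ s, F i r) (∑ i ∈ s, a i) (∑ i ∈ s, b i) (∑ i ∈ s, c i)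
      (∑ i ∈ s, d i) := by
  classical
  induction s using Finset.induction_on with
  | empty => simpa using JetAt.const (q := q) (v := v) (w := w) 0
  | insert i s hi ih => simpa [Finset.sum_insert hi] using (h i).add ih

lemma JetAt.unique (h : JetAt q v w F a b c d) (h' : JetAt q v w F a' b' c' d') :
    a = a' ∧ b = b' ∧ c = c' ∧ d = d' :=
  ⟨h.value.symm.trans h'.value, h.fst.symm.trans h'.fst, h.snd.symm.trans h'.snd,
    h.mixed.symm.trans h'.mixed⟩

/-- The constraints on the second order jet at the identity of a family of matrices of
determinant one. -/
lemma JetAt.det_eq_one {N : V → Matrix (Fin 3) (Fin 3) ℝ} {A B C : Matrix (Fin 3) (Fin 3) ℝ}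
    (hN : ∀ i j, JetAt q v w (fun r => N r i j) ((1 : Matrix (Fin 3) (Fin 3) ℝ) i j) (A i j)
      (B i j) (C i j)) (hdet : ∀ r, (N r).det = 1) :
    ∑ i, A i i = 0 ∧ ∑ i, B i i = 0 ∧ ∑ i, C i i = ∑ i, ∑ j, A i j * B j i := by
  -- Jets of all triple products of entries, to be assembled into the Leibniz formula. At the
  -- identity the mixed derivative of `det` is `tr C + tr A tr B - tr (AB)`.
  have h3 := fun i j k l m n => ((hN i j).mul (hN k l)).mul (hN m n)
  have h := (((((h3 0 0 1 1 2 2).sub (h3 0 0 1 2 2 1)).sub (h3 0 1 1 0 2 2)).add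
    (h3 0 1 1 2 2 0)).add (h3 0 2 1 0 2 1)).sub (h3 0 2 1 1 2 0)
  have hc : JetAt q v w (fun r => (N r).det) 1 0 0 0 := by
    simp only [hdet]; exact JetAt.const 1
  simp only [Matrix.det_fin_three] at hc
  obtain ⟨-, h1, h2, h4⟩ := h.unique hc
  simp at h1 h2 h4
  simp only [Fin.sum_univ_three]
  refine ⟨by linarith, by linarith, ?_⟩
  have h1' : A 0 0 + A 1 1 + A 2 2 = 0 := by linarith
  have h2' : B 0 0 + B 1 1 + B 2 2 = 0 := by linarith
  linear_combination h4 - (A 0 0 + A 1 1 + A 2 2) * h2'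

/-- The jet of the Gram matrix of a family of matrices. -/
lemma JetAt.gram {N : V → Matrix (Fin 3) (Fin 3) ℝ} {A B C : Matrix (Fin 3) (Fin 3) ℝ}
    (hN : ∀ i j, JetAt q v w (fun r => N r i j) ((1 : Matrix (Fin 3) (Fin 3) ℝ) i j) (A i j)
      (B i j) (C i j)) (i j : Fin 3) :
    JetAt q v w (fun r => ∑ k, N r k i * N r k j) ((1 : Matrix (Fin 3) (Fin 3) ℝ) i j)
      (A i j + A j i) (B i j + B j i)
      (C i j + C j i + ∑ k, (A k i * B k j + B k i * A k j)) := by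
  refine (JetAt.sum Finset.univ fun k => (hN k i).mul (hN k j)).congr ?_ ?_ ?_ ?_ <;>
    simp [Finset.sum_add_distrib, Matrix.one_apply, add_comm, add_left_comm, eq_comm]

end Jets

/-! ### Differentiation under the integral sign -/

section ParametricIntegral

variable {P : Type} [NormedAddCommGroup P]

/-- The difference from the value at parameter `0` is continuous and supported in `K`. -/
lemma integrable_param {h : P × E3 → ℝ} (hh : Continuous h) {K : Set E3} (hK : IsCompact K)
    {r : ℝ} (hconst : ∀ p : P, ‖p‖ < r → ∀ y ∉ K, h (p, y) = h (0, y))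
    (hint : Integrable fun y => h (0, y)) {p : P} (hp : ‖p‖ < r) :
    Integrable fun y => h (p, y) := by
  have h1 : Integrable fun y => h (p, y) - h (0, y) :=
    Continuous.integrable_of_hasCompactSupport (by fun_prop)
      (HasCompactSupport.intro hK fun y hy => by rw [hconst p hp y hy, sub_self])
  exact (h1.add hint).congr (Filter.Eventually.of_forall fun y => by simp)

variable [NormedSpace ℝ P]

/-- Along the line `t ↦ p₀ + t v` the integral of a smooth function whose dependence on the
parameter is compactly supported may be differentiated under the integral sign. -/
lemma hasDerivAt_integral_line {h : P × E3 → ℝ} (hh : ContDiff ℝ ∞ h) {K : Set E3}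
    (hK : IsCompact K) {r : ℝ} (hconst : ∀ p : P, ‖p‖ < r → ∀ y ∉ K, h (p, y) = h (0, y))
    {p₀ : P} (hp₀ : ‖p₀‖ < r) (hint : Integrable fun y => h (p₀, y)) (v : P) :
    HasDerivAt (fun t : ℝ => ∫ y, h (p₀ + t • v, y)) (∫ y, fderiv ℝ h (p₀, y) (v, 0)) 0 := by
  have hcont : Continuous fun t : ℝ => p₀ + t • v := by fun_prop
  have hderiv : ∀ (t : ℝ) (y : E3), HasDerivAt (fun t : ℝ => h (p₀ + t • v, y))
      (fderiv ℝ h (p₀ + t • v, y) (v, 0)) t := fun t y => by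
    have h1 : HasDerivAt (fun t : ℝ => ((p₀ + t • v, y) : P × E3)) (v, 0) t := by
      have h2 := ((hasDerivAt_id t).smul_const v).const_add p₀
      rw [one_smul] at h2
      exact h2.prodMk (hasDerivAt_const t y)
    exact ((hh.differentiable (by simp) _).hasFDerivAt).comp_hasDerivAt t h1
  have hU : {t : ℝ | ‖p₀ + t • v‖ < r} ∈ nhds (0 : ℝ) :=
    (isOpen_lt (by fun_prop) continuous_const).mem_nhds (by simpa using hp₀)
  obtain ⟨ε, hε, hball⟩ := Metric.nhds_basis_closedBall.mem_iff.1 hU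
  have hF' : Continuous fun z : ℝ × E3 => fderiv ℝ h (p₀ + z.1 • v, z.2) (v, 0) := by
    have := hh.continuous_fderiv (by simp)
    fun_prop
  -- The dominating function is this constant on `K` and `0` elsewhere, since off `K` the integrand
  -- does not depend on `t` near `0`.
  obtain ⟨C, hC⟩ := ((isCompact_closedBall (0 : ℝ) ε).prod hK).exists_bound_of_continuousOn
    hF'.continuousOn
  have key := hasDerivAt_integral_of_dominated_loc_of_deriv_le (μ := volume)
    (F := fun (t : ℝ) y => h (p₀ + t • v, y)) (x₀ := (0 : ℝ))
    (F' := fun (t : ℝ) y => fderiv ℝ h (p₀ + t • v, y) (v, 0))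
    (bound := K.indicator fun _ => C) (Metric.ball_mem_nhds (0 : ℝ) hε)
    (Filter.Eventually.of_forall fun t => by
      have := hh.continuous
      exact (by fun_prop : Continuous fun y => h (p₀ + t • v, y)).aestronglyMeasurable)
    (by simpa using hint)
    ((hF'.comp (Continuous.prodMk_right (0 : ℝ))).aestronglyMeasurable)
    (Filter.Eventually.of_forall fun y t ht => by
      by_cases hy : y ∈ K
      · rw [Set.indicator_of_mem hy]
        exact hC (t, y) ⟨Metric.ball_subset_closedBall ht, hy⟩
      · rw [Set.indicator_of_notMem hy]
        have : HasDerivAt (fun t : ℝ => h (p₀ + t • v, y)) 0 t := by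
          refine (hasDerivAt_const t (h (0, y))).congr_of_eventuallyEq ?_
          filter_upwards [Metric.isOpen_ball.mem_nhds ht] with s hs
          exact hconst _ (hball (Metric.ball_subset_closedBall hs)) y hy
        rw [(hderiv t y).unique this, norm_zero])
    ((integrable_indicator_iff hK.measurableSet).2 (integrableOn_const hK.measure_lt_top.ne))
    (Filter.Eventually.of_forall fun y t _ => hderiv t y)
  simpa using key.2

/-- The directional derivative in the parameter vanishes where the function does not depend on
the parameter. -/
lemma fderiv_param_eq_zero {h : P × E3 → ℝ} (hh : ContDiff ℝ ∞ h) {y : E3} {r : ℝ}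
    (hconst : ∀ p : P, ‖p‖ < r → h (p, y) = h (0, y)) {p : P} (hp : ‖p‖ < r) (w : P) :
    fderiv ℝ h (p, y) (w, 0) = 0 := by
  have h1 : HasFDerivAt (fun p : P => h (p, y))
      ((fderiv ℝ h (p, y)).comp (ContinuousLinearMap.inl ℝ P E3)) p :=
    (hh.differentiable (by simp) (p, y)).hasFDerivAt.comp p (hasFDerivAt_prodMk_left p y)
  have h2 : HasFDerivAt (fun p : P => h (p, y)) (0 : P →L[ℝ] ℝ) p := by
    refine (hasFDerivAt_const (h (0, y)) p).congr_of_eventuallyEq ?_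
    filter_upwards [(isOpen_lt continuous_norm continuous_const).mem_nhds hp] with q hq
    exact hconst q hq
  exact congrArg (fun T => T w) (h1.unique h2)

/-- Mixed second derivative of the integral of a smooth function whose dependence on two
parameters is compactly supported. -/
lemma hasMixedDeriv_integral {h : (ℝ × ℝ) × E3 → ℝ} (hh : ContDiff ℝ ∞ h) {K : Set E3}
    (hK : IsCompact K) {r : ℝ} (hr : 0 < r)
    (hconst : ∀ p : ℝ × ℝ, ‖p‖ < r → ∀ y ∉ K, h (p, y) = h (0, y))
    (hint : Integrable fun y => h (0, y)) :
    HasMixedDeriv (fun s t => ∫ y, h ((s, t), y))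
      (∫ y, fderiv ℝ (fun q => fderiv ℝ h q ((0, 1), 0)) (0, y) ((1, 0), 0)) := by
  have hk : ContDiff ℝ ∞ fun q => fderiv ℝ h q (((0, 1), 0) : (ℝ × ℝ) × E3) :=
    (hh.fderiv_right (by simp)).clm_apply contDiff_const
  have hk0 : ∀ p : ℝ × ℝ, ‖p‖ < r → ∀ y ∉ K, fderiv ℝ h (p, y) ((0, 1), 0) = 0 :=
    fun p hp y hy => fderiv_param_eq_zero hh (fun p hp => hconst p hp y hy) hp _
  have h0 : ‖(0 : ℝ × ℝ)‖ < r := by simpa using hr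
  refine ⟨fun s => ∫ y, fderiv ℝ h ((s, 0), y) ((0, 1), 0), ?_, ?_⟩
  · filter_upwards [Metric.ball_mem_nhds (0 : ℝ) hr] with s hs
    -- The norm on `ℝ × ℝ` is the maximum norm, so `‖(s, 0)‖ = |s|`.
    have hs' : ‖((s, 0) : ℝ × ℝ)‖ < r := by
      simpa [Prod.norm_def, hr] using hs
    simpa using hasDerivAt_integral_line hh hK hconst hs'
      (integrable_param hh.continuous hK hconst hint hs') (0, 1)
  · have := hasDerivAt_integral_line hk hK
      (fun p hp y hy => by rw [hk0 p hp y hy, hk0 0 h0 y hy]) h0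
      (Continuous.integrable_of_hasCompactSupport (hk.continuous.comp (by fun_prop))
        (HasCompactSupport.intro hK fun y hy => hk0 0 h0 y hy)) (1, 0)
    simpa using this

end ParametricIntegral

/-! ### Smooth families of volume preserving diffeomorphisms -/

section Families

variable {P : Type} [NormedAddCommGroup P] [NormedSpace ℝ P]

/-- The evaluation map of a family of diffeomorphisms. -/
noncomputable def evalMap (ψ : P → (E3 ≃ₘ[ℝ] E3)) (q : P × E3) : E3 := ψ q.1 q.2

/-- The inverse evaluation map of a family of diffeomorphisms. -/
noncomputable def evalInv (ψ : P → (E3 ≃ₘ[ℝ] E3)) (q : P × E3) : E3 := (ψ q.1).symm q.2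

/-- The matrix of the differential of `ψ_p` at the preimage of a point. -/
noncomputable def jacobianMatrix (ψ : P → (E3 ≃ₘ[ℝ] E3)) (q : P × E3) :
    Matrix (Fin 3) (Fin 3) ℝ :=
  Matrix.of fun i j => fderiv ℝ (evalMap ψ) (q.1, evalInv ψ q) (0, stdVec j) i

/-- The infinitesimal generator of a family of diffeomorphisms in a given parameter direction. -/
noncomputable def generator (ψ : P → (E3 ≃ₘ[ℝ] E3)) (w : P) (x : E3) : E3 :=
  fderiv ℝ (evalMap ψ) (0, x) (w, 0)

/-- The matrix of partial derivatives of a vector field. -/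
noncomputable def jacobian (X : E3 → E3) (x : E3) : Matrix (Fin 3) (Fin 3) ℝ :=
  Matrix.of fun i j => fderiv ℝ X x (stdVec j) i

lemma det_eq_det_matrix (T : E3 →L[ℝ] E3) :
    (Matrix.of fun i j => T (stdVec j) i : Matrix (Fin 3) (Fin 3) ℝ).det = T.det := by
  rw [ContinuousLinearMap.det,
    ← LinearMap.det_toMatrix (EuclideanSpace.basisFun (Fin 3) ℝ).toBasis]
  congr 1

variable {ψ : P → (E3 ≃ₘ[ℝ] E3)}

lemma IsSmoothFamily.contDiff_evalMap (hψ : IsSmoothFamily ψ) : ContDiff ℝ ∞ (evalMap ψ) :=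
  hψ.smooth

lemma fderiv_evalMap_snd (hψ : IsSmoothFamily ψ) (p : P) (x v : E3) :
    fderiv ℝ (evalMap ψ) (p, x) (0, v) = fderiv ℝ (ψ p) x v := by
  have h1 : HasFDerivAt (ψ p)
      ((fderiv ℝ (evalMap ψ) (p, x)).comp (ContinuousLinearMap.inr ℝ P E3)) x :=
    ((hψ.contDiff_evalMap.differentiable (by simp)) (p, x)).hasFDerivAt.comp x
      (hasFDerivAt_prodMk_right p x)
  rw [h1.fderiv]
  rfl

/-- The inverse function theorem is applied to `Φ (p, x) = (p, ψ_p x)`. Its differential is block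
triangular with a diagonal block of determinant one, hence injective, hence invertible in finite
dimension. -/
lemma IsSmoothFamily.contDiff_evalInv [FiniteDimensional ℝ P] (hψ : IsSmoothFamily ψ) :
    ContDiff ℝ ∞ (evalInv ψ) := by
  let Φ : P × E3 → P × E3 := fun q => (q.1, evalMap ψ q)
  have hΦ : ContDiff ℝ ∞ Φ := contDiff_fst.prodMk hψ.contDiff_evalMap
  have hinj : Function.Injective Φ := by
    rintro ⟨p, x⟩ ⟨p', x'⟩ h
    obtain ⟨rfl, h2⟩ := Prod.mk.inj h
    exact Prod.ext rfl ((ψ p).injective h2)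
  have hright : ∀ q, Φ (q.1, evalInv ψ q) = q := fun q =>
    Prod.ext rfl ((ψ q.1).apply_symm_apply q.2)
  rw [contDiff_iff_contDiffAt]
  intro q
  set r : P × E3 := (q.1, evalInv ψ q) with hr
  have hd : fderiv ℝ Φ r = (ContinuousLinearMap.fst ℝ P E3).prod (fderiv ℝ (evalMap ψ) r) :=
    (hasFDerivAt_fst.prodMk
      ((hψ.contDiff_evalMap.differentiable (by simp)) r).hasFDerivAt).fderiv
  have hdinj : Function.Injective (fderiv ℝ Φ r) := by
    rw [injective_iff_map_eq_zero]
    rintro ⟨p, v⟩ h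
    rw [hd] at h
    obtain ⟨h1, h2⟩ := Prod.mk.inj h
    have h1 : p = 0 := h1
    subst h1
    have h2 : fderiv ℝ (evalMap ψ) r (0, v) = 0 := h2
    rw [hr, fderiv_evalMap_snd hψ] at h2
    have hdet : LinearMap.det (fderiv ℝ (ψ q.1) (evalInv ψ q) : E3 →ₗ[ℝ] E3) ≠ 0 := by
      have : LinearMap.det (fderiv ℝ (ψ q.1) (evalInv ψ q) : E3 →ₗ[ℝ] E3) = 1 :=
        (hψ.mem q.1).1 _
      rw [this]; exact one_ne_zero
    have hker := (LinearMap.equivOfDetNeZero _ hdet).injective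
    have h3 : v = 0 := hker ((show _ = (0 : E3) from h2).trans (map_zero _).symm)
    rw [h3]; rfl
  let e : (P × E3) ≃L[ℝ] (P × E3) :=
    (LinearEquiv.ofInjectiveEndo (fderiv ℝ Φ r : P × E3 →ₗ[ℝ] P × E3)
      hdinj).toContinuousLinearEquiv
  have he : HasFDerivAt Φ (e : P × E3 →L[ℝ] P × E3) r := by
    have hee : (e : P × E3 →L[ℝ] P × E3) = fderiv ℝ Φ r := ContinuousLinearMap.ext fun _ => rfl
    rw [hee]
    exact (hΦ.differentiable (by simp) r).hasFDerivAt
  have hs : HasStrictFDerivAt Φ (e : P × E3 →L[ℝ] P × E3) r :=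
    hΦ.contDiffAt.hasStrictFDerivAt' he (by simp)
  have hl : ContDiffAt ℝ ∞ (hs.localInverse Φ e r) (Φ r) :=
    hΦ.contDiffAt.to_localInverse he (by simp)
  have hev := hs.eventually_right_inverse
  rw [hright q] at hl hev
  refine (contDiff_snd.contDiffAt.comp q hl).congr_of_eventuallyEq ?_
  -- The local inverse and `(p, y) ↦ (p, ψ_p⁻¹ y)` are both right inverses of the injective map `Φ`,
  -- so they agree near `q`.
  filter_upwards [hev] with z hz
  have := hinj ((hright z).trans hz.symm)
  exact congrArg Prod.snd this

lemma evalInv_zero (hψ : IsSmoothFamily ψ) (y : E3) : evalInv ψ (0, y) = y := by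
  have h := hψ.zero ((ψ 0).symm y)
  rw [(ψ 0).apply_symm_apply] at h
  exact h.symm

lemma fderiv_zero_eq_id (hψ : IsSmoothFamily ψ) (x v : E3) :
    fderiv ℝ (evalMap ψ) (0, x) (0, v) = v := by
  have h : (ψ 0 : E3 → E3) = id := funext hψ.zero
  rw [fderiv_evalMap_snd hψ, h, fderiv_id]
  rfl

lemma contDiff_jacobianMatrix [FiniteDimensional ℝ P] (hψ : IsSmoothFamily ψ) (i j : Fin 3) :
    ContDiff ℝ ∞ fun q => jacobianMatrix ψ q i j := by
  have h1 : ContDiff ℝ ∞ fun q => fderiv ℝ (evalMap ψ) q ((0 : P), stdVec j) :=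
    (hψ.contDiff_evalMap.fderiv_right (by simp)).clm_apply contDiff_const
  have h2 : ContDiff ℝ ∞ fun q => fderiv ℝ (evalMap ψ) (q.1, evalInv ψ q) ((0 : P), stdVec j) :=
    h1.comp (contDiff_fst.prodMk hψ.contDiff_evalInv)
  exact (EuclideanSpace.proj (𝕜 := ℝ) i).contDiff.comp h2

lemma jacobianMatrix_zero (hψ : IsSmoothFamily ψ) (y : E3) : jacobianMatrix ψ (0, y) = 1 := by
  ext i j
  simp [jacobianMatrix, fderiv_zero_eq_id hψ, stdVec, Matrix.one_apply]

lemma det_jacobianMatrix (hψ : IsSmoothFamily ψ) (q : P × E3) : (jacobianMatrix ψ q).det = 1 := by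
  rw [← (hψ.mem q.1).1 (evalInv ψ q), ← det_eq_det_matrix]
  simp only [jacobianMatrix, fderiv_evalMap_snd hψ]

lemma jacobianMatrix_of_notMem (hψ : IsSmoothFamily ψ) {K : Set E3} (hK : IsCompact K) {p : P}
    (h : ∀ x, x ∉ K → ψ p x = x) {y : E3} (hy : y ∉ K) : jacobianMatrix ψ (p, y) = 1 := by
  have h1 : evalInv ψ (p, y) = y := by
    have := congrArg (ψ p).symm (h y hy)
    rw [(ψ p).symm_apply_apply] at this
    exact this.symm
  have h2 : fderiv ℝ (ψ p) y = ContinuousLinearMap.id ℝ E3 := by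
    have : (ψ p : E3 → E3) =ᶠ[nhds y] id := by
      filter_upwards [hK.isClosed.isOpen_compl.mem_nhds hy] with x hx using h x hx
    rw [this.fderiv_eq, fderiv_id]
  ext i j
  simp [jacobianMatrix, fderiv_evalMap_snd hψ, h1, h2, stdVec, Matrix.one_apply]

lemma gram_eq_jacobianMatrix (hψ : IsSmoothFamily ψ) (p : P) (y : E3) :
    gram (fderiv ℝ (ψ p) ((ψ p).symm y)) = fun i j =>
      ∑ k, jacobianMatrix ψ (p, y) k i * jacobianMatrix ψ (p, y) k j := by
  ext i j
  simp only [gram, inner_E3, jacobianMatrix, fderiv_evalMap_snd hψ, Fin.sum_univ_three,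
    Matrix.of_apply, evalInv]

/-- Motion of the base point `ψ_p⁻¹ y` contributes nothing at `p = 0`, because `Dψ_0` is the
identity everywhere. What remains is a mixed parameter-space derivative of `ψ`, and symmetry of
second derivatives turns it into the Jacobian of the generator. -/
lemma fderiv_jacobianMatrix [FiniteDimensional ℝ P] (hψ : IsSmoothFamily ψ) (w : P) (y : E3)
    (i j : Fin 3) :
    fderiv ℝ (fun q => jacobianMatrix ψ q i j) (0, y) (w, 0) = jacobian (generator ψ w) y i j := by
  have hΨ := hψ.contDiff_evalMap
  have hD : ContDiff ℝ ∞ (fderiv ℝ (evalMap ψ)) := hΨ.fderiv_right (by simp)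
  have hD' := hD.differentiable (by simp)
  have hspace : ∀ u z, fderiv ℝ (fun x => fderiv ℝ (evalMap ψ) ((0 : P), x) u) y z =
      fderiv ℝ (fderiv ℝ (evalMap ψ)) (0, y) (0, z) u := fun u z => by
    have h1 : HasFDerivAt (fun x => fderiv ℝ (evalMap ψ) ((0 : P), x))
        ((fderiv ℝ (fderiv ℝ (evalMap ψ)) (0, y)).comp (ContinuousLinearMap.inr ℝ P E3)) y :=
      (hD' (0, y)).hasFDerivAt.comp y (hasFDerivAt_prodMk_right 0 y)
    rw [(h1.clm_apply (hasFDerivAt_const u y)).fderiv]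
    simp
  have hz : ∀ z, fderiv ℝ (fderiv ℝ (evalMap ψ)) (0, y) (0, z) (0, stdVec j) = 0 := fun z => by
    rw [← hspace]
    simp [fderiv_zero_eq_id hψ]
  have hχ : HasFDerivAt (fun q : P × E3 => (q.1, evalInv ψ q))
      ((ContinuousLinearMap.fst ℝ P E3).prod (fderiv ℝ (evalInv ψ) (0, y))) (0, y) :=
    hasFDerivAt_fst.prodMk ((hψ.contDiff_evalInv.differentiable (by simp)) (0, y)).hasFDerivAt
  have hD0 : HasFDerivAt (fderiv ℝ (evalMap ψ)) (fderiv ℝ (fderiv ℝ (evalMap ψ)) (0, y))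
      ((0 : P), evalInv ψ (0, y)) := by
    rw [evalInv_zero hψ]
    exact (hD' (0, y)).hasFDerivAt
  have h3 : HasFDerivAt (fun q : P × E3 => fderiv ℝ (evalMap ψ) (q.1, evalInv ψ q))
      ((fderiv ℝ (fderiv ℝ (evalMap ψ)) (0, y)).comp
        ((ContinuousLinearMap.fst ℝ P E3).prod (fderiv ℝ (evalInv ψ) (0, y)))) (0, y) :=
    HasFDerivAt.comp (0, y) hD0 hχ
  have h4 := h3.clm_apply (hasFDerivAt_const ((0 : P), stdVec j) ((0 : P), y))
  have h5 : HasFDerivAt (fun q => jacobianMatrix ψ q i j) _ (0, y) :=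
    (EuclideanSpace.proj (𝕜 := ℝ) i).hasFDerivAt.comp (0, y) h4
  rw [h5.fderiv]
  have hsymm : IsSymmSndFDerivAt ℝ (evalMap ψ) (0, y) :=
    hΨ.contDiffAt.isSymmSndFDerivAt (by simpa using ENat.LEInfty.out)
  have hsplit : ((w, fderiv ℝ (evalInv ψ) (0, y) (w, 0)) : P × E3) =
      (w, 0) + (0, fderiv ℝ (evalInv ψ) (0, y) (w, 0)) := by simp
  have h6 : jacobian (generator ψ w) y i j =
      fderiv ℝ (fderiv ℝ (evalMap ψ)) (0, y) (0, stdVec j) (w, 0) i := by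
    rw [← hspace]; rfl
  rw [h6, hsymm (0, stdVec j) (w, 0)]
  have h7 : fderiv ℝ (fderiv ℝ (evalMap ψ)) (0, y) (w, fderiv ℝ (evalInv ψ) (0, y) (w, 0))
      (0, stdVec j) = fderiv ℝ (fderiv ℝ (evalMap ψ)) (0, y) (w, 0) (0, stdVec j) := by
    rw [hsplit, map_add, add_apply, hz, add_zero]
  rw [← h7]
  simp

end Families

/-! ### First and second variation of the density -/

/-- The inner product of the strain tensors of two vector fields. -/
noncomputable def strainProduct (X Y : E3 → E3) (y : E3) : ℝ :=
  ∑ i, ∑ j, (jacobian X y i j + jacobian X y j i) * (jacobian Y y i j + jacobian Y y j i)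

/-- The weight of the hessian of `F_α` at inverse stereographic projection. -/
noncomputable def hessianWeight (α : ℝ) (y : E3) : ℝ :=
  α / 2 * conformalFactor y ^ 2 + 2 * (1 - α) * conformalFactor y ^ 4

section Density

variable {P : Type} [NormedAddCommGroup P] [NormedSpace ℝ P]

/-- Used for the powers of the conformal factor, which after transport to the image do not vary with
the parameter. -/
lemma JetAt.comp_snd {f : E3 → ℝ} (hf : ContDiff ℝ ∞ f) (p : P) (y : E3) (v w : P) :
    JetAt (p, y) (v, 0) (w, 0) (fun q : P × E3 => f q.2) (f y) 0 0 0 := by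
  have h : ∀ (q : P × E3) (u : P), fderiv ℝ (fun q : P × E3 => f q.2) q (u, 0) = 0 := fun q u => by
    have h1 : HasFDerivAt (fun q : P × E3 => f q.2)
        ((fderiv ℝ f q.2).comp (ContinuousLinearMap.snd ℝ P E3)) q :=
      (hf.differentiable (by simp) q.2).hasFDerivAt.comp q hasFDerivAt_snd
    rw [h1.fderiv]
    simp
  refine ⟨hf.comp contDiff_snd, rfl, h _ _, h _ _, ?_⟩
  simp [h]

/-- The density of `F_α(φ ∘ ψ_p)`, transported to the image. -/
noncomputable def familyDensity (α : ℝ) (ψ : P → (E3 ≃ₘ[ℝ] E3)) (q : P × E3) : ℝ :=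
  skyrmeDensity α q.2 fun i j => ∑ k, jacobianMatrix ψ q k i * jacobianMatrix ψ q k j

variable {ψ : P → (E3 ≃ₘ[ℝ] E3)}

/-- The first variation of the density vanishes pointwise, and its second variation is a multiple
of the inner product of the strain tensors. -/
lemma jetAt_familyDensity [FiniteDimensional ℝ P] (hψ : IsSmoothFamily ψ) (α : ℝ) (y : E3)
    (v w : P) :
    JetAt (0, y) (v, 0) (w, 0) (familyDensity α ψ) (familyDensity α ψ (0, y)) 0 0
      (hessianWeight α y * strainProduct (generator ψ v) (generator ψ w) y) := by
  set A := jacobian (generator ψ v) y with hA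
  set B := jacobian (generator ψ w) y with hB
  set C : Matrix (Fin 3) (Fin 3) ℝ := Matrix.of fun i j =>
    fderiv ℝ (fun r => fderiv ℝ (fun q => jacobianMatrix ψ q i j) r (w, 0)) (0, y) (v, 0)
  have hN : ∀ i j, JetAt (0, y) (v, 0) (w, 0) (fun q => jacobianMatrix ψ q i j)
      ((1 : Matrix (Fin 3) (Fin 3) ℝ) i j) (A i j) (B i j) (C i j) := fun i j =>
    (JetAt.of_contDiff (contDiff_jacobianMatrix hψ i j)).congr
      (by rw [jacobianMatrix_zero hψ]) (fderiv_jacobianMatrix hψ v y i j)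
      (fderiv_jacobianMatrix hψ w y i j) rfl
  obtain ⟨h1, h2, h3⟩ := JetAt.det_eq_one hN (det_jacobianMatrix hψ)
  have hG := JetAt.gram hN
  have hc2 := JetAt.comp_snd (contDiff_conformalFactor.pow 2) (0 : P) y v w
  have hc4 := JetAt.comp_snd (contDiff_conformalFactor.pow 4) (0 : P) y v w
  have hj := ((JetAt.const α).mul ((JetAt.const (1 / 2)).mul
      (hc2.mul (JetAt.sum Finset.univ fun i => hG i i)))).add
    ((JetAt.const (1 - α)).mul (hc4.mul (JetAt.sum Finset.univ fun i =>
      JetAt.sum Finset.univ fun j => ((hG i i).mul (hG j j)).sub ((hG i j).mul (hG i j)))))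
  have hj' : JetAt (0, y) (v, 0) (w, 0) (familyDensity α ψ) _ _ _ _ := hj
  refine hj'.congr hj'.value.symm ?_ ?_ ?_
  · simp only [Fin.sum_univ_three] at h1 ⊢
    simp
    -- At `G = 1`, `∑ G_ii` varies by `2 tr A` and `∑ (G_ii G_jj - G_ij²)` by `(6 - 2) · 2 tr A`,
    -- which explains the factors `1/2 · 2` and `8`.
    linear_combination (α * conformalFactor y ^ 2 + 8 * (1 - α) * conformalFactor y ^ 4) * h1
  · simp only [Fin.sum_univ_three] at h2 ⊢
    simp
    linear_combination (α * conformalFactor y ^ 2 + 8 * (1 - α) * conformalFactor y ^ 4) * h2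
  · simp only [strainProduct, hessianWeight, Fin.sum_univ_three, ← hA, ← hB] at h1 h2 h3 ⊢
    simp
    -- `C` enters only through its trace, with the same coefficient as in the first variation; `h3`
    -- trades it for `tr (AB)`. The last term removes the product `tr A tr B` coming from the
    -- squared trace of `G`.
    linear_combination (α * conformalFactor y ^ 2 + 8 * (1 - α) * conformalFactor y ^ 4) * h3 +
      8 * (1 - α) * conformalFactor y ^ 4 * (B 0 0 + B 1 1 + B 2 2) * h1

lemma contDiff_familyDensity [FiniteDimensional ℝ P] (hψ : IsSmoothFamily ψ) (α : ℝ) :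
    ContDiff ℝ ∞ (familyDensity α ψ) :=
  (jetAt_familyDensity hψ α 0 0 0).smooth

end Density

/-! ### The hessian as a bilinear form -/

lemma jacobian_add {X Y : E3 → E3} (hX : ContDiff ℝ ∞ X) (hY : ContDiff ℝ ∞ Y) (y : E3) :
    jacobian (X + Y) y = jacobian X y + jacobian Y y := by
  ext i j
  have h : fderiv ℝ (X + Y) y = fderiv ℝ X y + fderiv ℝ Y y :=
    fderiv_add (hX.differentiable (by simp) y) (hY.differentiable (by simp) y)
  simp [jacobian, h]

lemma jacobian_smul {X : E3 → E3} (hX : ContDiff ℝ ∞ X) (c : ℝ) (y : E3) :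
    jacobian (c • X) y = c • jacobian X y := by
  ext i j
  have h : fderiv ℝ (c • X) y = c • fderiv ℝ X y :=
    fderiv_const_smul (hX.differentiable (by simp) y) c
  simp [jacobian, h]

lemma strainProduct_add_left {X X' : E3 → E3} (hX : ContDiff ℝ ∞ X) (hX' : ContDiff ℝ ∞ X')
    (Y : E3 → E3) (y : E3) :
    strainProduct (X + X') Y y = strainProduct X Y y + strainProduct X' Y y := by
  simp only [strainProduct, jacobian_add hX hX', Matrix.add_apply, ← Finset.sum_add_distrib]
  exact Finset.sum_congr rfl fun i _ => Finset.sum_congr rfl fun j _ => by ring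

lemma strainProduct_smul_left {X : E3 → E3} (hX : ContDiff ℝ ∞ X) (c : ℝ) (Y : E3 → E3) (y : E3) :
    strainProduct (c • X) Y y = c * strainProduct X Y y := by
  simp only [strainProduct, jacobian_smul hX, Matrix.smul_apply, Finset.mul_sum, smul_eq_mul]
  exact Finset.sum_congr rfl fun i _ => Finset.sum_congr rfl fun j _ => by ring

lemma strainProduct_comm (X Y : E3 → E3) (y : E3) : strainProduct X Y y = strainProduct Y X y :=
  Finset.sum_congr rfl fun _ _ => Finset.sum_congr rfl fun _ _ => mul_comm _ _

lemma strainProduct_self_nonneg (X : E3 → E3) (y : E3) : 0 ≤ strainProduct X X y :=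
  Finset.sum_nonneg fun _ _ => Finset.sum_nonneg fun _ _ => mul_self_nonneg _

lemma hessianWeight_nonneg {α : ℝ} (hα : α ∈ Set.Icc (0 : ℝ) 1) (y : E3) :
    0 ≤ hessianWeight α y := by
  have h1 := hα.1
  have h2 := sub_nonneg.2 hα.2
  unfold hessianWeight
  positivity

lemma continuous_jacobian {X : E3 → E3} (hX : ContDiff ℝ ∞ X) (i j : Fin 3) :
    Continuous fun y => jacobian X y i j := by
  have := hX.continuous_fderiv (by simp)
  simp only [jacobian, Matrix.of_apply]
  fun_prop

lemma continuous_hessianWeight (α : ℝ) : Continuous (hessianWeight α) := by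
  have := contDiff_conformalFactor.continuous
  unfold hessianWeight
  fun_prop

lemma integrable_hessianDensity (α : ℝ) {X Y : E3 → E3} (hX : ContDiff ℝ ∞ X)
    (hX' : HasCompactSupport X) (hY : ContDiff ℝ ∞ Y) :
    Integrable fun y => hessianWeight α y * strainProduct X Y y := by
  have h1 := continuous_jacobian hX
  have h2 := continuous_jacobian hY
  have h3 := continuous_hessianWeight α
  refine Continuous.integrable_of_hasCompactSupport (by unfold strainProduct; fun_prop) ?_
  refine HasCompactSupport.intro hX'.isCompact fun y hy => ?_
  have h4 : fderiv ℝ X y = 0 := fderiv_of_notMem_tsupport ℝ hy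
  simp [strainProduct, jacobian, h4]

/-- The hessian of `F_α` at inverse stereographic projection. -/
noncomputable def hessianForm (α : ℝ) : LinearMap.BilinForm ℝ Gamma0 :=
  LinearMap.mk₂ ℝ (fun X Y : Gamma0 => ∫ y, hessianWeight α y * strainProduct X Y y)
    (fun X X' Y => by
      rw [← integral_add (integrable_hessianDensity α X.2.1 X.2.2.1 Y.2.1)
        (integrable_hessianDensity α X'.2.1 X'.2.2.1 Y.2.1)]
      refine integral_congr_ae (Filter.Eventually.of_forall fun y => ?_)
      simp only [Submodule.coe_add, strainProduct_add_left X.2.1 X'.2.1, mul_add])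
    (fun c X Y => by
      rw [smul_eq_mul, ← integral_const_mul]
      refine integral_congr_ae (Filter.Eventually.of_forall fun y => ?_)
      simp only [Submodule.coe_smul, strainProduct_smul_left X.2.1]
      ring)
    (fun X Y Y' => by
      rw [← integral_add (integrable_hessianDensity α X.2.1 X.2.2.1 Y.2.1)
        (integrable_hessianDensity α X.2.1 X.2.2.1 Y'.2.1)]
      refine integral_congr_ae (Filter.Eventually.of_forall fun y => ?_)
      simp only [Submodule.coe_add, strainProduct_comm X, strainProduct_add_left Y.2.1 Y'.2.1,
        mul_add])
    (fun c X Y => by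
      rw [smul_eq_mul, ← integral_const_mul]
      refine integral_congr_ae (Filter.Eventually.of_forall fun y => ?_)
      simp only [Submodule.coe_smul, strainProduct_comm X, strainProduct_smul_left Y.2.1]
      ring)

lemma hessianForm_apply (α : ℝ) (X Y : Gamma0) :
    hessianForm α X Y = ∫ y, hessianWeight α y * strainProduct X Y y := rfl

lemma hessianForm_self_nonneg {α : ℝ} (hα : α ∈ Set.Icc (0 : ℝ) 1) (X : Gamma0) :
    0 ≤ hessianForm α X X :=
  integral_nonneg fun y => mul_nonneg (hessianWeight_nonneg hα y) (strainProduct_self_nonneg X y)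

/-! ### Integrability of the density -/

lemma conformalFactor_le_two (y : E3) : conformalFactor y ≤ 2 := by
  have h := conformalFactor_mul y
  nlinarith [conformalFactor_pos y, sq_nonneg ‖y‖]

lemma integrable_conformalFactor_sq : Integrable fun y : E3 => conformalFactor y ^ 2 := by
  -- `λ² = 4 (1 + |y|²)^(-4/2)`, and the exponent `4` exceeds the dimension `3`.
  have h := (integrable_rpow_neg_one_add_norm_sq (E := E3) (μ := volume) (r := 4)
    (by simp; norm_num)).const_mul 4
  refine h.congr (Filter.Eventually.of_forall fun y => ?_)
  simp only [conformalFactor, add_comm (1 : ℝ)]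
  rw [div_pow]
  norm_num [div_eq_mul_inv]

lemma integrable_conformalFactor_pow_four : Integrable fun y : E3 => conformalFactor y ^ 4 := by
  refine (integrable_conformalFactor_sq.const_mul 4).mono'
    (contDiff_conformalFactor.continuous.pow 4).aestronglyMeasurable
    (Filter.Eventually.of_forall fun y => ?_)
  have h0 := (conformalFactor_pos y).le
  have h1 : conformalFactor y ^ 2 ≤ 2 ^ 2 := pow_le_pow_left₀ h0 (conformalFactor_le_two y) 2
  rw [Real.norm_of_nonneg (by positivity)]
  nlinarith [sq_nonneg (conformalFactor y)]

lemma integrable_skyrmeDensity (α : ℝ) (G : Fin 3 → Fin 3 → ℝ) :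
    Integrable fun y => skyrmeDensity α y G :=
  (((integrable_conformalFactor_sq.mul_const _).const_mul _).const_mul α).add
    ((integrable_conformalFactor_pow_four.mul_const _).const_mul (1 - α))

/-! ### The energy along a family -/

section Family

variable {P : Type} [NormedAddCommGroup P] [NormedSpace ℝ P] {ψ : P → (E3 ≃ₘ[ℝ] E3)}

lemma integrable_familyDensity_zero (hψ : IsSmoothFamily ψ) (α : ℝ) :
    Integrable fun y => familyDensity α ψ (0, y) := by
  simp only [familyDensity, jacobianMatrix_zero hψ]
  exact integrable_skyrmeDensity α _

/-- The parameters of norm less than one lie in a compact ball, so one compact set supports all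
these diffeomorphisms; outside it the Jacobian matrix is `1`. -/
lemma exists_familyDensity_eq [FiniteDimensional ℝ P] (hψ : IsSmoothFamily ψ) (α : ℝ) :
    ∃ K : Set E3, IsCompact K ∧ ∀ p : P, ‖p‖ < 1 → ∀ y ∉ K,
      familyDensity α ψ (p, y) = familyDensity α ψ (0, y) := by
  have : ProperSpace P := FiniteDimensional.proper ℝ P
  obtain ⟨K, hK, h⟩ := hψ.support (Metric.closedBall 0 1) (isCompact_closedBall 0 1)
  refine ⟨K, hK, fun p hp y hy => ?_⟩
  simp only [familyDensity, jacobianMatrix_zero hψ,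
    jacobianMatrix_of_notMem hψ hK (h p (by simpa using hp.le)) hy]

lemma Falpha_family_toReal [FiniteDimensional ℝ P] (hψ : IsSmoothFamily ψ) {α : ℝ}
    (hα : α ∈ Set.Icc (0 : ℝ) 1) (p : P) :
    (Falpha α (invStereo ∘ ψ p)).toReal = ∫ y, familyDensity α ψ (p, y) := by
  have h : ∀ y, skyrmeDensity α y (gram (fderiv ℝ (ψ p) ((ψ p).symm y))) =
      familyDensity α ψ (p, y) := fun y => by
    rw [gram_eq_jacobianMatrix hψ]; rfl
  rw [Falpha_comp_invStereo hα (hψ.mem p), integral_eq_lintegral_of_nonneg_ae]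
  · simp only [h]
  · exact Filter.Eventually.of_forall fun y => by
      simp only [← h]; exact skyrmeDensity_gram_nonneg hα y _
  · exact ((contDiff_familyDensity hψ α).continuous.comp
      (Continuous.prodMk_right p)).aestronglyMeasurable

end Family

/-! ### Criticality and stability -/

lemma refl_mem_SDiff : Diffeomorph.refl (modelWithCornersSelf ℝ E3) E3 ∞ ∈ SDiff := by
  refine ⟨fun x => ?_, by simp⟩
  have h : (Diffeomorph.refl (modelWithCornersSelf ℝ E3) E3 ∞ : E3 → E3) = id := rfl
  rw [h, fderiv_id]
  exact LinearMap.det_id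

/-- The transported formula for the identity diffeomorphism has a constant Gram matrix, leaving
integrable powers of the conformal factor. -/
lemma Falpha_invStereo_ne_top {α : ℝ} (hα : α ∈ Set.Icc (0 : ℝ) 1) : Falpha α invStereo ≠ ⊤ := by
  have h := Falpha_comp_invStereo hα refl_mem_SDiff
  have h1 : (Diffeomorph.refl (modelWithCornersSelf ℝ E3) E3 ∞ : E3 → E3) = id := rfl
  simp only [h1, Function.comp_id, fderiv_id] at h
  rw [h]
  exact (integrable_skyrmeDensity α _).lintegral_lt_top.ne

lemma isRestrictedCritical_invStereo {α : ℝ} (hα : α ∈ Set.Icc (0 : ℝ) 1) :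
    IsRestrictedCritical (Falpha α) invStereo := by
  refine ⟨isSmoothMap_invStereo, Falpha_invStereo_ne_top hα, fun ψ hψ => ?_⟩
  simp only [Falpha_family_toReal hψ hα]
  obtain ⟨K, hK, hconst⟩ := exists_familyDensity_eq hψ α
  have h := hasDerivAt_integral_line (contDiff_familyDensity hψ α) hK hconst (p₀ := 0)
    (by simp) (integrable_familyDensity_zero hψ α) 1
  -- The integrand of the derivative is identically zero; no integration by parts is needed.
  simpa [(jetAt_familyDensity hψ α _ 1 1).fst] using h

/-- Identifies the generators of a variation with its prescribed tangent fields `X`, `Y`. -/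
lemma generator_eq {P : Type} [NormedAddCommGroup P] [NormedSpace ℝ P] {ψ : P → (E3 ≃ₘ[ℝ] E3)}
    (hψ : IsSmoothFamily ψ) (w : P) {X : E3 → E3}
    (h : ∀ x, HasDerivAt (fun t : ℝ => ψ (t • w) x) (X x) 0) : generator ψ w = X := by
  ext1 x
  have h1 : HasDerivAt (fun t : ℝ => ((t • w, x) : P × E3)) (w, 0) 0 := by
    have h2 := (hasDerivAt_id (0 : ℝ)).smul_const w
    rw [one_smul] at h2
    exact h2.prodMk (hasDerivAt_const 0 x)
  have h3 : HasFDerivAt (evalMap ψ) (fderiv ℝ (evalMap ψ) (0, x)) ((0 : ℝ) • w, x) := by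
    rw [zero_smul]
    exact (hψ.contDiff_evalMap.differentiable (by simp) _).hasFDerivAt
  have h4 : HasDerivAt (evalMap ψ ∘ fun t : ℝ => ((t • w, x) : P × E3))
      (fderiv ℝ (evalMap ψ) (0, x) (w, 0)) 0 :=
    h3.comp_hasDerivAt (0 : ℝ) h1
  exact h4.unique (h x)

lemma isHessian_hessianForm {α : ℝ} (hα : α ∈ Set.Icc (0 : ℝ) 1) :
    IsHessian (Falpha α) invStereo (hessianForm α) := by
  intro X Y ψ hψ
  have hf := hψ.family
  simp only [Falpha_family_toReal hf hα]
  obtain ⟨K, hK, hconst⟩ := exists_familyDensity_eq hf α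
  have h := hasMixedDeriv_integral (contDiff_familyDensity hf α) hK one_pos hconst
    (integrable_familyDensity_zero hf α)
  have hX : generator ψ (1, 0) = X := generator_eq hf _ fun x => by
    simpa using hψ.tangent_fst x
  have hY : generator ψ (0, 1) = Y := generator_eq hf _ fun x => by
    simpa using hψ.tangent_snd x
  rw [hessianForm_apply]
  simpa only [(jetAt_familyDensity hf α _ (1, 0) (0, 1)).mixed, hX, hY] using h

end Skyrme

theorem mainTheorem5 (α : ℝ) (hα : α ∈ Set.Icc (0 : ℝ) 1) :
    Skyrme.IsStableRestrictedCritical (Skyrme.Falpha α) Skyrme.invStereo := by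
  exact ⟨Skyrme.isRestrictedCritical_invStereo hα, Skyrme.hessianForm α,
    Skyrme.isHessian_hessianForm hα, Skyrme.hessianForm_self_nonneg hα⟩
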